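/- **Setting.** A *cofinality spectrum problem* (CSP) $\mathbf s=(M,N,M^+,N^+,\Delta)$ consists of first-order structures $M\preceq N$, expansions $M^+\preceq N^+$ of them to a larger language $\mathscr L^+$, and a set $\Delta$ of formulas $\varphi(\bar x,\bar y;\bar z)$ with $\ell(\bar x)=\ell(\bar y)$ in the language of $N$, together with the following orders and trees ("definable" means definable with parameters in $N^+$). *Orders.* For $\varphi\in\Delta$ and $\bar c$ in $N$, the formula $\varphi(\bar x,\bar y;\bar c)$ defines a discrete linear order on $X=\{\bar a:N\models\varphi(\bar a,\bar a;\bar c)\}$, with a first element if $X\neq\emptyset$, such that every nonempty definable subset of $X$ that is bounded in $X$ has a first and a last element. $\operatorname{Or}(\mathbf s)$ is a set of orders $\mathbf a=(X_{\mathbf a},\le_{\mathbf a},\varphi_{\mathbf a},\bar c_{\mathbf a},d_{\mathbf a})$ of this kind with a designated element $d_{\mathbf a}\in X_{\mathbf a}$, in which each such nonempty $X$ occurs with at least one designated element. Let $0_{\mathbf a}=\min X_{\mathbf a}$; $\mathbf a$ is *nontrivial* if $d_{\mathbf a}$ is not a finite successor of $0_{\mathbf a}$. For all $\mathbf a,\mathbf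 b\in\operatorname{Or}(\mathbf s)$ there are $\mathbf c\in\operatorname{Or}(\mathbf s)$ and a definable bijection $X_{\mathbf a}\times X_{\mathbf b}\to X_{\mathbf c}$, with $\mathbf c$ nontrivial if $\mathbf a$ and $\mathbf b$ are. For some nontrivial $\mathbf a\in\operatorname{Or}(\mathbf s)$ there are $\mathbf c\in\operatorname{Or}(\mathbf s)$ and a definable bijection $\mathrm{Pr}:X_{\mathbf a}\times X_{\mathbf a}\to X_{\mathbf c}$ such that for each $z\in X_{\mathbf a}$ there is $y\in X_{\mathbf c}$ with $\max(x_1,x_2)\le_{\mathbf a}z\iff \mathrm{Pr}(x_1,x_2)\le_{\mathbf c}y$ for all $x_1,x_2\in X_{\mathbf a}$. *Trees.* To each $\mathbf a\in\operatorname{Or}(\mathbf s)$ belongs a tree $(\mathcal T_{\mathbf a},\trianglelefteq_{\mathbf a})$. Its elements $t$ code, extensionally, functions from an initial segment $\{m:m<_{\mathbf a}\operatorname{lgn}(t)\}$ of $X_{\mathbf a}$ to $X_{\mathbf a}$, where $\operatorname{lgn}(t)\in X_{\mathbf a}$; $\trianglelefteq_{\mathbf a}$ is the initial segment relation; the empty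 function belongs to $\mathcal T_{\mathbf a}$; and if $t\in\mathcal T_{\mathbf a}$, $\operatorname{lgn}(t)<_{\mathbf a}d_{\mathbf a}$ and $x\in X_{\mathbf a}$, then $t^\smallfrown\langle x\rangle\in\mathcal T_{\mathbf a}$. Membership in $\mathcal T_{\mathbf a}$, length, value at a point and $\trianglelefteq_{\mathbf a}$ are defined in $N^+$ by $\mathscr L^+$-formulas depending only on $\varphi_{\mathbf a}$, from the parameters $\bar c_{\mathbf a},d_{\mathbf a}$. For regular (infinite) $\kappa_1,\kappa_2$, a *$(\kappa_1,\kappa_2)$-cut* in $X_{\mathbf a}$ is a strictly increasing sequence $\langle a_\alpha:\alpha<\kappa_1\rangle$ and a strictly decreasing sequence $\langle b_\beta:\beta<\kappa_2\rangle$ in $X_{\mathbf a}$ with $a_\alpha<_{\mathbf a}b_\beta$ for all $\alpha,\beta$, such that no $x\in X_{\mathbf a}$ satisfies $a_\alpha<_{\mathbf a}x<_{\mathbf a}b_\beta$ for all $\alpha,\beta$. Let $\mathfrak p_{\mathbf s}$ be the least $\kappa_1+\kappa_2$ such that some $X_{\mathbf a}$, $\mathbf a\in\operatorname{Or}(\mathbf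 s)$, has a $(\kappa_1,\kappa_2)$-cut. Let $\mathfrak t_{\mathbf s}$ be the least $\kappa$ such that some $\mathcal T_{\mathbf a}$, $\mathbf a\in\operatorname{Or}(\mathbf s)$, has a strictly $\trianglelefteq_{\mathbf a}$-increasing $\kappa$-indexed sequence with no upper bound in $\mathcal T_{\mathbf a}$ (with $\min\emptyset=\infty$). An *$\operatorname{Or}$-type* over $A\subseteq N$ is a (partial) type $p(x_0,\dots,x_{n-1})$, i.e. a set of $\mathscr L^+$-formulas with parameters in $A$ that is finitely satisfiable in $N^+$, such that for each $i<n$ there is $\mathbf a_i\in\operatorname{Or}(\mathbf s)$, with $\mathbf a_i$ nontrivial or $X_{\mathbf a_i}$ finite, for which $p$ implies $x_i\in X_{\mathbf a_i}$ (modulo the elementary diagram of $N^+$). **Lemma.** Let $\mathbf s$ be a CSP and $\kappa<\min\{\mathfrak p_{\mathbf s},\mathfrak t_{\mathbf s}\}$. 1. If $\kappa$ is infinite and $|\mathscr L^+|\le\kappa$ (for instance, if $\mathscr L^+$ is countable), then every $\operatorname{Or}$-type over a set $A\subseteq N$ of size at most $\kappa$ is realized in $N^+$. 2. For $\mathscr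 L^+$ of any size, every $\operatorname{Or}$-type that consists of at most $\kappa$ formulas (with any parameters from $N$) is realized in $N^+$. -/

import Mathlib

open FirstOrder FirstOrder.Language Cardinal

universe u u₁ v₁ u₂ v₂

/-- A first-order formula `φ(x̄, ȳ; z̄)` with `ℓ(x̄) = ℓ(ȳ)`. -/
structure OrderFormula (L : FirstOrder.Language.{u₁, v₁}) where
  nx : ℕ
  nz : ℕ
  formula : L.Formula ((Fin nx ⊕ Fin nx) ⊕ Fin nz)

namespace OrderFormula

variable {L : FirstOrder.Language.{u₁, v₁}} {N : Type u} [L.Structure N]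

/-- The relation `φ(x̄, ȳ; c̄)` in `N`. -/
def le (φ : OrderFormula L) (c : Fin φ.nz → N) (x y : Fin φ.nx → N) : Prop :=
  φ.formula.Realize (Sum.elim (Sum.elim x y) c)

/-- The set `{x̄ : N ⊨ φ(x̄, x̄; c̄)}`. -/
def carrier (φ : OrderFormula L) (c : Fin φ.nz → N) : Set (Fin φ.nx → N) :=
  {x | φ.le c x x}

/-- The strict part of `φ(·, ·; c̄)`. -/
def lt (φ : OrderFormula L) (c : Fin φ.nz → N) (x y : Fin φ.nx → N) : Prop :=
  φ.le c x y ∧ x ≠ y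

/-- `φ(x̄, ȳ; c̄)` is a discrete linear order on its carrier `X`, with a first element unless `X` is
empty, and pseudofinite: every nonempty bounded subset of `X` which is definable, with parameters,
in the structure `N` for the larger language `L'` has a last and a first element. (Reflexivity on
`X` holds by definition of `X`.) -/
structure IsPseudofiniteOrder (L' : FirstOrder.Language.{u₂, v₂}) [L'.Structure N]
    (φ : OrderFormula L) (c : Fin φ.nz → N) : Prop where
  antisymm : ∀ x ∈ φ.carrier c, ∀ y ∈ φ.carrier c, φ.le c x y → φ.le c y x → x = y
  trans : ∀ x ∈ φ.carrier c, ∀ y ∈ φ.carrier c, ∀ z ∈ φ.carrier c,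
    φ.le c x y → φ.le c y z → φ.le c x z
  total : ∀ x ∈ φ.carrier c, ∀ y ∈ φ.carrier c, φ.le c x y ∨ φ.le c y x
  exists_first : (φ.carrier c).Nonempty → ∃ x ∈ φ.carrier c, ∀ y ∈ φ.carrier c, φ.le c x y
  exists_succ : ∀ x ∈ φ.carrier c, (∃ y ∈ φ.carrier c, φ.lt c x y) →
    ∃ y ∈ φ.carrier c, φ.lt c x y ∧ ∀ z ∈ φ.carrier c, φ.lt c x z → φ.le c y z
  exists_pred : ∀ x ∈ φ.carrier c, (∃ y ∈ φ.carrier c, φ.lt c y x) →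
    ∃ y ∈ φ.carrier c, φ.lt c y x ∧ ∀ z ∈ φ.carrier c, φ.lt c z x → φ.le c z y
  pseudofinite : ∀ D : Set (Fin φ.nx → N), D ⊆ φ.carrier c → D.Nonempty →
    (Set.univ : Set N).Definable L' D → (∃ b ∈ φ.carrier c, ∀ x ∈ D, φ.le c x b) →
    (∃ m ∈ D, ∀ x ∈ D, φ.le c x m) ∧ (∃ m ∈ D, ∀ x ∈ D, φ.le c m x)

end OrderFormula

/-- The data `(φ_a, c̄_a, d_a)` of a definable order in `N` with a designated element. -/
structure DefOrder (L : FirstOrder.Language.{u₁, v₁}) (N : Type u) where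
  form : OrderFormula L
  par : Fin form.nz → N
  desig : Fin form.nx → N

namespace DefOrder

variable {L : FirstOrder.Language.{u₁, v₁}} {N : Type u}

/-- Tuples of the length of the elements of `X_a`. -/
abbrev Pt (a : DefOrder L N) : Type u := Fin a.form.nx → N

variable [L.Structure N]

/-- `X_a`. -/
def X (a : DefOrder L N) : Set a.Pt := a.form.carrier a.par

/-- `x ≤_a y`. -/
def le (a : DefOrder L N) (x y : a.Pt) : Prop := a.form.le a.par x y

/-- `x <_a y`. -/
def lt (a : DefOrder L N) (x y : a.Pt) : Prop := a.le x y ∧ x ≠ y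

/-- `x` is the least element `0_a` of `X_a`. -/
def IsZero (a : DefOrder L N) (x : a.Pt) : Prop := x ∈ a.X ∧ ∀ y ∈ a.X, a.le x y

/-- `y` is the immediate successor of `x` in `X_a`. -/
def IsSucc (a : DefOrder L N) (x y : a.Pt) : Prop :=
  x ∈ a.X ∧ y ∈ a.X ∧ a.lt x y ∧ ∀ z ∈ a.X, a.lt x z → a.le y z

/-- `a` is nontrivial: `d_a` is not a finite successor of `0_a`, that is, the interval
`[0_a, d_a]` is infinite. -/
def IsNontrivial (a : DefOrder L N) : Prop := {x | x ∈ a.X ∧ a.le x a.desig}.Infinite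

/-- `pr` is a bijection of `X_a × X_b` onto `X_c` whose graph (equivalently, its inverse, that is the
pair of coordinate projections) is definable with parameters in the structure `N` for `L'`. -/
def IsProduct (L' : FirstOrder.Language.{u₂, v₂}) [L'.Structure N] (a b c : DefOrder L N)
    (pr : a.Pt → b.Pt → c.Pt) : Prop :=
  Set.BijOn (fun q : a.Pt × b.Pt => pr q.1 q.2) (a.X ×ˢ b.X) c.X ∧
  (Set.univ : Set N).Definable L'
    {v : (Fin a.form.nx ⊕ Fin b.form.nx) ⊕ Fin c.form.nx → N |
      (v ∘ Sum.inl ∘ Sum.inl) ∈ a.X ∧ (v ∘ Sum.inl ∘ Sum.inr) ∈ b.X ∧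
      v ∘ Sum.inr = pr (v ∘ Sum.inl ∘ Sum.inl) (v ∘ Sum.inl ∘ Sum.inr)}

/-- `X_a` has a `(κ₁, κ₂)`-cut, for `κ₁, κ₂` (infinite) regular: an unfilled pre-cut, given by a
strictly increasing `κ₁`-sequence lying below a strictly decreasing `κ₂`-sequence. -/
def HasCut (a : DefOrder L N) (κ₁ κ₂ : Cardinal.{u}) : Prop :=
  κ₁.IsRegular ∧ κ₂.IsRegular ∧
  ∃ f g : Ordinal.{u} → a.Pt,
    (∀ α < κ₁.ord, f α ∈ a.X) ∧ (∀ β < κ₂.ord, g β ∈ a.X) ∧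
    (∀ α β, α < β → β < κ₁.ord → a.lt (f α) (f β)) ∧
    (∀ α β, α < β → β < κ₂.ord → a.lt (g β) (g α)) ∧
    (∀ α < κ₁.ord, ∀ β < κ₂.ord, a.lt (f α) (g β)) ∧
    ¬ ∃ x ∈ a.X, (∀ α < κ₁.ord, a.lt (f α) x) ∧ (∀ β < κ₂.ord, a.lt x (g β))

end DefOrder

/-- Formulas of `L'` which define, uniformly in the parameters `(c̄_a, d_a)`, the trees attached to
the orders `a` given by the formula `φ`: membership, length, evaluation and tree order. Tree
elements are coded by tuples of length `nt`. -/
structure TreeFormulas {L : FirstOrder.Language.{u₁, v₁}} (L' : FirstOrder.Language.{u₂, v₂}) (φ : OrderFormula L) where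
  nt : ℕ
  mem : L'.Formula (Fin nt ⊕ (Fin φ.nz ⊕ Fin φ.nx))
  lgn : L'.Formula ((Fin nt ⊕ Fin φ.nx) ⊕ (Fin φ.nz ⊕ Fin φ.nx))
  val : L'.Formula ((Fin nt ⊕ (Fin φ.nx ⊕ Fin φ.nx)) ⊕ (Fin φ.nz ⊕ Fin φ.nx))
  le : L'.Formula ((Fin nt ⊕ Fin nt) ⊕ (Fin φ.nz ⊕ Fin φ.nx))

namespace DefOrder

variable {L : FirstOrder.Language.{u₁, v₁}} {L' : FirstOrder.Language.{u₂, v₂}} {N : Type u} [L'.Structure N]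

/-- The underlying set of `𝒯_a`. -/
def Tree (a : DefOrder L N) (τ : TreeFormulas L' a.form) : Set (Fin τ.nt → N) :=
  {t | τ.mem.Realize (Sum.elim t (Sum.elim a.par a.desig))}

/-- `lgn_a(t) = n`. -/
def Lgn (a : DefOrder L N) (τ : TreeFormulas L' a.form) (t : Fin τ.nt → N) (n : a.Pt) : Prop :=
  τ.lgn.Realize (Sum.elim (Sum.elim t n) (Sum.elim a.par a.desig))

/-- `t(m) = y`. -/
def Val (a : DefOrder L N) (τ : TreeFormulas L' a.form) (t : Fin τ.nt → N) (m y : a.Pt) : Prop :=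
  τ.val.Realize (Sum.elim (Sum.elim t (Sum.elim m y)) (Sum.elim a.par a.desig))

/-- `t ⊴_a t'`. -/
def TreeLe (a : DefOrder L N) (τ : TreeFormulas L' a.form) (t t' : Fin τ.nt → N) : Prop :=
  τ.le.Realize (Sum.elim (Sum.elim t t') (Sum.elim a.par a.desig))

/-- `𝒯_a` is a tree of partial functions from `X_a` to itself, ordered by initial segment: every
`t ∈ 𝒯_a` has a length in `X_a` and is a function from `{m ∈ X_a : m <_a lgn_a(t)}` to `X_a`; an
element of `𝒯_a` is determined by its length and values; the empty function belongs to `𝒯_a`; and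
if `lgn_a(t) <_a d_a` then `t⌢⟨x⟩ ∈ 𝒯_a` for every `x ∈ X_a`. -/
structure IsTree [L.Structure N] (a : DefOrder L N) (τ : TreeFormulas L' a.form) : Prop where
  lgn_unique : ∀ t ∈ a.Tree τ, ∃! n, a.Lgn τ t n
  lgn_mem : ∀ t ∈ a.Tree τ, ∀ n, a.Lgn τ t n → n ∈ a.X
  val_unique : ∀ t ∈ a.Tree τ, ∀ n, a.Lgn τ t n → ∀ m ∈ a.X, a.lt m n → ∃! y, a.Val τ t m y
  val_mem : ∀ t ∈ a.Tree τ, ∀ n, a.Lgn τ t n → ∀ m ∈ a.X, a.lt m n →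
    ∀ y, a.Val τ t m y → y ∈ a.X
  ext : ∀ t ∈ a.Tree τ, ∀ t' ∈ a.Tree τ, ∀ n, a.Lgn τ t n → a.Lgn τ t' n →
    (∀ m ∈ a.X, a.lt m n → ∀ y, a.Val τ t m y ↔ a.Val τ t' m y) → t = t'
  empty_mem : ∃ t ∈ a.Tree τ, ∃ n, a.Lgn τ t n ∧ a.IsZero n
  concat : ∀ t ∈ a.Tree τ, ∀ n, a.Lgn τ t n → a.lt n a.desig → ∀ x ∈ a.X,
    ∃ t' ∈ a.Tree τ, (∃ n', a.Lgn τ t' n' ∧ a.IsSucc n n') ∧ a.Val τ t' n x ∧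
      ∀ m ∈ a.X, a.lt m n → ∀ y, a.Val τ t' m y ↔ a.Val τ t m y
  treeLe_iff : ∀ t ∈ a.Tree τ, ∀ t' ∈ a.Tree τ, ∀ n n', a.Lgn τ t n → a.Lgn τ t' n' →
    (a.TreeLe τ t t' ↔ a.le n n' ∧
      ∀ m ∈ a.X, a.lt m n → ∀ y, a.Val τ t m y ↔ a.Val τ t' m y)

/-- In `𝒯_a` there is a strictly `⊴_a`-increasing `κ`-indexed sequence with no upper bound. -/
def HasUnboundedPath (a : DefOrder L N) (τ : TreeFormulas L' a.form) (κ : Cardinal.{u}) : Prop :=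
  ∃ f : Ordinal.{u} → (Fin τ.nt → N),
    (∀ α < κ.ord, f α ∈ a.Tree τ) ∧
    (∀ α β, α < β → β < κ.ord → a.TreeLe τ (f α) (f β) ∧ f α ≠ f β) ∧
    ¬ ∃ t ∈ a.Tree τ, ∀ α < κ.ord, a.TreeLe τ (f α) t

end DefOrder

/-- A cofinality spectrum problem `(M, N, M⁺, N⁺, Δ)`. The structures `N` and `N⁺` are the
`L`-structure and the `L'`-structure on the type `N`. -/
structure CofinalitySpectrumProblem {L : FirstOrder.Language.{u₁, v₁}} {L' : FirstOrder.Language.{u₂, v₂}}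
    (ι : L →ᴸ L') (N : Type u) [L.Structure N] [L'.Structure N] where
  /-- `N⁺` is an expansion of `N`. -/
  isExpansion : ι.IsExpansionOn N
  M : L.ElementarySubstructure N
  Mplus : L'.ElementarySubstructure N
  carrier_eq : (M : Set N) = (Mplus : Set N)
  Δ : Set (OrderFormula L)
  isOrder : ∀ φ ∈ Δ, ∀ c : Fin φ.nz → N, φ.IsPseudofiniteOrder L' c
  /-- `Or(s)`: the orders, each with a choice of a designated element. -/
  Or : Set (DefOrder L N)
  form_mem : ∀ a ∈ Or, a.form ∈ Δ
  desig_mem : ∀ a ∈ Or, a.desig ∈ a.X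
  exists_desig : ∀ φ ∈ Δ, ∀ c : Fin φ.nz → N, (φ.carrier c).Nonempty →
    ∃ d, (⟨φ, c, d⟩ : DefOrder L N) ∈ Or
  /-- Closure under Cartesian products. -/
  exists_prod : ∀ a ∈ Or, ∀ b ∈ Or, ∃ c ∈ Or, (∃ pr, DefOrder.IsProduct L' a b c pr) ∧
    (a.IsNontrivial → b.IsNontrivial → c.IsNontrivial)
  /-- For some nontrivial `a` there is a product `a × a` whose order is compatible with `≤_a`: the
  squares `{x : x ≤_a z}²` are initial segments, as for the Gödel pairing function. -/
  exists_pairing : ∃ a ∈ Or, a.IsNontrivial ∧ ∃ c ∈ Or, ∃ pr, DefOrder.IsProduct L' a a c pr ∧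
    ∀ z ∈ a.X, ∃ y ∈ c.X, ∀ x₁ ∈ a.X, ∀ x₂ ∈ a.X,
      (a.le x₁ z ∧ a.le x₂ z) ↔ c.le (pr x₁ x₂) y
  /-- The formulas defining the trees, uniformly for all orders with the same formula. -/
  tree : ∀ φ : OrderFormula L, TreeFormulas L' φ
  isTree : ∀ a ∈ Or, a.IsTree (tree a.form)

namespace CofinalitySpectrumProblem

variable {L : FirstOrder.Language.{u₁, v₁}} {L' : FirstOrder.Language.{u₂, v₂}} {ι : L →ᴸ L'} {N : Type u}
  [L.Structure N] [L'.Structure N]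

/-- `𝔭_s`: the least `κ₁ + κ₂` such that some `X_a` has a `(κ₁, κ₂)`-cut (`⊤` if there is none). -/
noncomputable def p (s : CofinalitySpectrumProblem ι N) : WithTop Cardinal.{u} :=
  sInf {k | ∃ a ∈ s.Or, ∃ κ₁ κ₂ : Cardinal.{u}, a.HasCut κ₁ κ₂ ∧
    k = ((κ₁ + κ₂ : Cardinal.{u}) : WithTop Cardinal.{u})}

/-- `𝔱_s`: the least `κ` such that some `𝒯_a` has a strictly increasing `κ`-indexed sequence with
no upper bound (`⊤` if there is none). -/
noncomputable def t (s : CofinalitySpectrumProblem ι N) : WithTop Cardinal.{u} :=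
  sInf {k | ∃ a ∈ s.Or, ∃ κ : Cardinal.{u}, a.HasUnboundedPath (s.tree a.form) κ ∧
    k = (κ : WithTop Cardinal.{u})}

/-- A set `p(x₀, …, xₙ₋₁)` of formulas of `L'` over `A ⊆ N⁺`, where `xᵢ` is a tuple of variables of
the length of the elements of `X_{aᵢ}`, is an `Or`-type in `X_{a₀}, …, X_{aₙ₋₁}`: it is consistent
(finitely satisfiable in `N⁺`) and it implies `xᵢ ∈ X_{aᵢ}` for each `i`, where `aᵢ ∈ Or(s)` is
nontrivial or finite. By compactness, `p` implies a formula over `N⁺` iff some finite part of `p`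
does so in `N⁺`. -/
structure IsOrType (s : CofinalitySpectrumProblem ι N) (A : Set N) {n : ℕ}
    (a : Fin n → DefOrder L N)
    (p : Set (L'[[A]].Formula (Σ i : Fin n, Fin (a i).form.nx))) : Prop where
  mem_or : ∀ i, a i ∈ s.Or
  nontrivial_or_finite : ∀ i, (a i).IsNontrivial ∨ (a i).X.Finite
  finitelySatisfiable : ∀ q ⊆ p, q.Finite →
    ∃ v : (Σ i : Fin n, Fin (a i).form.nx) → N, ∀ φ ∈ q, φ.Realize v
  implies_mem : ∀ i, ∃ q ⊆ p, q.Finite ∧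
    ∀ v : (Σ i : Fin n, Fin (a i).form.nx) → N, (∀ φ ∈ q, φ.Realize v) →
      (fun j => v ⟨i, j⟩) ∈ (a i).X

/-- The set `p` of formulas over `A` is realized in `N⁺`. -/
def IsRealized {A : Set N} {V : Type} (p : Set (L'[[A]].Formula V)) : Prop :=
  ∃ v : V → N, ∀ φ ∈ p, φ.Realize v

end CofinalitySpectrumProblem

/-!
The parameters of an `Or`-type are unrestricted, so the variables can be treated one at a time
(`CofinalitySpectrumProblem.exists_assignment`), and it suffices to know that each single order
`X_a` is saturated: a family of at most `κ` definable subsets of `X_a` with the finite intersection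
property has a common point. A type in `n` variables never has to be coded into one order by means
of products. For finite `X_a` there is nothing to prove.

For nontrivial `a` the proof (`CodedTree.sInter_nonempty`) is by induction on the number of sets.
Enumerate the family as `⟨D_α : α < κ⟩`. One constructs an increasing sequence `t_α`, `α ≤ κ`, in the
tree of `a` such that all values of `t_α` at points `m ≥ lgn(t_β)`, for `β < α`, lie in `D_β`; the
value of `t_κ` at the predecessor of its length then lies in every `D_β`.
* At a successor step, append to `t_α` a common point of the `D_β`, `β ≤ α`. These are fewer than
  `κ` sets, so the induction hypothesis applies.
* At a limit step, `κ < 𝔱` provides an upper bound `t` of the sequence so far. By pseudofiniteness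
  there is, for each `β < α`, a last point `e_β` up to which the values of `t` from `lgn(t_β)` on stay
  in `D_β`, and all the lengths `lgn(t_γ)` lie below all the `e_β`. As `κ < 𝔭`, some `n` lies between
  them, and `t_α` is the restriction of `t` to `n`.

To keep the construction going, the lengths stay below all the finite predecessors of `d_a`. This
holds for the empty sequence because `a` is nontrivial, it is trivially preserved by successor steps,
and at a limit step the predecessors of `d_a` are added to the upper half of the pre-cut. That the
tree contains the restrictions of its elements follows from closure under `t ↦ t⌢⟨x⟩` by induction
along the pseudofinite order (`DefOrder.IsTree.exists_restrict`).
-/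

/-! ### Cofinal sequences and transfinite recursion -/

theorem Cardinal.mk_image_Iio_ordinal_le {X : Type u} (f : Ordinal.{u} → X) (o : Ordinal.{u}) :
    #(f '' Set.Iio o) ≤ o.card := by
  have h := mk_image_le_lift (f := f) (s := Set.Iio o)
  rw [mk_Iio_ordinal, Cardinal.lift_lift, ← Cardinal.lift_umax.{u, u + 1}] at h
  exact Cardinal.lift_le.1 (by simpa only [Cardinal.lift_umax] using h)

theorem Ordinal.exists_extend_toType {X : Type u₁} [Nonempty X] {o : Ordinal.{u}}
    (g : o.ToType → X) :
    ∃ f : Ordinal.{u} → X, ∀ α (h : α < o), f α = g (Ordinal.ToType.mk ⟨α, h⟩) := by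
  classical
  exact ⟨fun α => if h : α < o then g (Ordinal.ToType.mk ⟨α, h⟩) else Classical.arbitrary X,
    fun α h => dif_pos h⟩

theorem Ordinal.ToType.exists_mk_eq {o : Ordinal.{u}} (i : o.ToType) :
    ∃ (α : Ordinal.{u}) (h : α < o), Ordinal.ToType.mk ⟨α, h⟩ = i :=
  ⟨(Ordinal.ToType.mk.symm i).1, (Ordinal.ToType.mk.symm i).2, Ordinal.ToType.mk.apply_symm_apply i⟩

theorem Cardinal.exists_image_Iio_ord_eq {X : Type u} (S : Set X) (hS : S.Nonempty) :
    ∃ e : Ordinal.{u} → X, e '' Set.Iio (#S).ord = S := by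
  have : Nonempty X := hS.nonempty
  have h : #(#S).ord.ToType = #S := by simp
  obtain ⟨g⟩ := Cardinal.eq.1 h
  obtain ⟨f, hf⟩ := Ordinal.exists_extend_toType fun i => (g i : X)
  refine ⟨f, Set.Subset.antisymm ?_ fun x hx => ?_⟩
  · rintro _ ⟨α, hα, rfl⟩
    rw [hf α hα]
    exact (g _).2
  · obtain ⟨i, hi⟩ := g.surjective ⟨x, hx⟩
    obtain ⟨α, hα, rfl⟩ := i.exists_mk_eq
    exact ⟨α, hα, (hf α hα).trans (congrArg Subtype.val hi)⟩

/-- A nonempty linearly ordered set without a last element has a strictly increasing cofinal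
sequence whose length is a regular cardinal. -/
theorem exists_regular_cofinal_seq {X : Type u} [LinearOrder X] (C : Set X) (hC : C.Nonempty)
    (hmax : ∀ x ∈ C, ∃ y ∈ C, x < y) :
    ∃ c : Cardinal.{u}, c.IsRegular ∧ c ≤ #C ∧ ∃ f : Ordinal.{u} → X,
      (∀ α < c.ord, f α ∈ C) ∧ (∀ α β, α < β → β < c.ord → f α < f β) ∧
      ∀ x ∈ C, ∃ α < c.ord, x ≤ f α := by
  -- the records of a well-ordering of `C` are cofinal and well-ordered by `<`
  let W : Set C := {a | ∀ b, WellOrderingRel b a → b < a}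
  have hW : IsCofinal W := isCofinal_setOfPred_imp_lt _
  have hwf : WellFoundedLT W := by
    refine ⟨Subrelation.wf (r := InvImage WellOrderingRel (fun w : W => w.1)) ?_
      (InvImage.wf _ WellOrderingRel.isWellOrder.wf)⟩
    intro a b hab
    rcases trichotomous_of WellOrderingRel a.1 b.1 with h | h | h
    · exact h
    · exact absurd (Subtype.ext h) hab.ne
    · exact absurd (a.2 _ h) hab.asymm
  obtain ⟨S, hS, hS'⟩ := Ordinal.exists_ord_cof_eq W
  have hne : Nonempty C := hC.to_subtype
  have hneW : Nonempty W := hW.nonempty.to_subtype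
  have hnm : NoMaxOrder W := by
    refine ⟨fun w => ?_⟩
    obtain ⟨y, hy, hlt⟩ := hmax w.1 w.1.2
    obtain ⟨z, hz, hle⟩ := hW ⟨y, hy⟩
    exact ⟨⟨z, hz⟩, lt_of_lt_of_le (b := (⟨y, hy⟩ : C)) hlt hle⟩
  have hreg : (Order.cof W).IsRegular :=
    ⟨Order.aleph0_le_cof, (Order.cof_ord_cof W).ge⟩
  have e : (Order.cof W).ord.ToType ≃o S := by
    have : Ordinal.type (α := (Order.cof W).ord.ToType) (· < ·) =
        Ordinal.type (α := S) (· < ·) := by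
      rw [hS', Ordinal.type_toType]
    exact OrderIso.ofRelIsoLT (Ordinal.type_eq.1 this).some
  refine ⟨Order.cof W, hreg, (Order.cof_le_cardinalMk W).trans (mk_set_le W), ?_⟩
  have : Nonempty X := hC.nonempty
  obtain ⟨f, hf⟩ := Ordinal.exists_extend_toType fun i => ((e i).1.1.1 : X)
  refine ⟨f, fun α hα => ?_, fun α β hαβ hβ => ?_, fun x hx => ?_⟩
  · rw [hf α hα]
    exact (e _).1.1.2
  · rw [hf α (hαβ.trans hβ), hf β hβ]
    exact e.lt_iff_lt.2 (Ordinal.ToType.mk.lt_iff_lt.2 hαβ)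
  · obtain ⟨z, hz, hle⟩ := hW ⟨x, hx⟩
    obtain ⟨w, hw, hle'⟩ := hS ⟨z, hz⟩
    obtain ⟨i, hi⟩ := e.surjective ⟨w, hw⟩
    obtain ⟨α, hα, rfl⟩ := i.exists_mk_eq
    refine ⟨α, hα, ?_⟩
    rw [hf α hα, hi]
    exact le_trans (b := (z.1 : X)) hle hle'

/-- If every pre-cut given by two sequences of regular lengths at most `κ` is filled, then so is
every pre-cut `(A, B)` with `#A, #B ≤ κ` in which `A` has no last element. -/
theorem exists_between_of_regular_seq {X : Type u} [LinearOrder X] {κ : Cardinal.{u}}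
    (h : ∀ κ₁ κ₂ : Cardinal.{u}, κ₁.IsRegular → κ₂.IsRegular → κ₁ ≤ κ → κ₂ ≤ κ →
      ∀ f g : Ordinal.{u} → X, (∀ α β, α < β → β < κ₁.ord → f α < f β) →
        (∀ α β, α < β → β < κ₂.ord → g β < g α) →
        (∀ α < κ₁.ord, ∀ β < κ₂.ord, f α < g β) →
        ∃ x, (∀ α < κ₁.ord, f α < x) ∧ ∀ β < κ₂.ord, x < g β)
    (A B : Set X) (hA : #A ≤ κ) (hB : #B ≤ κ) (hA' : A.Nonempty) (hB' : B.Nonempty)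
    (hmax : ∀ x ∈ A, ∃ y ∈ A, x < y) (hAB : ∀ x ∈ A, ∀ y ∈ B, x < y) :
    ∃ n, (∀ x ∈ A, x < n) ∧ ∀ y ∈ B, n ≤ y := by
  by_cases hmin : ∃ y ∈ B, ∀ z ∈ B, y ≤ z
  · obtain ⟨y, hy, hyz⟩ := hmin
    exact ⟨y, fun x hx => hAB x hx y hy, hyz⟩
  push Not at hmin
  obtain ⟨κ₁, hκ₁, hle₁, f, hf, hfmono, hfcof⟩ := exists_regular_cofinal_seq A hA' hmax
  obtain ⟨κ₂, hκ₂, hle₂, g, hg, hgmono, hgcof⟩ :=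
    exists_regular_cofinal_seq (X := Xᵒᵈ) (OrderDual.ofDual ⁻¹' B) hB' hmin
  obtain ⟨x, hx1, hx2⟩ := h κ₁ κ₂ hκ₁ hκ₂ (hle₁.trans hA) (hle₂.trans hB) f
    (fun β => OrderDual.ofDual (g β)) hfmono hgmono (fun α hα β hβ => hAB _ (hf α hα) _ (hg β hβ))
  refine ⟨x, fun y hy => ?_, fun y hy => ?_⟩
  · obtain ⟨α, hα, hle⟩ := hfcof y hy
    exact hle.trans_lt (hx1 α hα)
  · obtain ⟨β, hβ, hle⟩ := hgcof (OrderDual.toDual y) hy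
    exact (hx2 β hβ).le.trans hle

/-- Transfinite recursion for a construction whose requirements concern single stages (`P`) and
pairs of stages (`R`). -/
theorem exists_ordinal_seq {T : Type u₁} [Nonempty T] (o : Ordinal.{u})
    (P : Ordinal.{u} → T → Prop) (R : Ordinal.{u} → T → Ordinal.{u} → T → Prop)
    (step : ∀ α ≤ o, ∀ f : Ordinal.{u} → T, (∀ β < α, P β (f β)) →
      (∀ γ β, γ < β → β < α → R γ (f γ) β (f β)) → ∃ t, P α t ∧ ∀ β < α, R β (f β) α t) :
    ∃ f : Ordinal.{u} → T, (∀ α ≤ o, P α (f α)) ∧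
      ∀ β α, β < α → α ≤ o → R β (f β) α (f α) := by
  classical
  let F : (α : Ordinal.{u}) → ((β : Ordinal.{u}) → β < α → T) → T := fun α ih =>
    if h : ∃ t, P α t ∧ ∀ β (hb : β < α), R β (ih β hb) α t then h.choose
    else Classical.arbitrary T
  let f : Ordinal.{u} → T := WellFounded.fix (wellFounded_lt (α := Ordinal.{u})) F
  have hf : ∀ α, f α = F α (fun β _ => f β) := fun α => WellFounded.fix_eq _ F α
  have key : ∀ α ≤ o, P α (f α) ∧ ∀ β < α, R β (f β) α (f α) := by
    intro α
    induction α using WellFoundedLT.induction with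
    | ind α ih =>
      intro hα
      have h := step α hα f (fun β hβ => (ih β hβ (hβ.le.trans hα)).1)
        (fun γ β hγ hβ => (ih β hβ (hβ.le.trans hα)).2 γ hγ)
      have hfα : f α = h.choose := by
        rw [hf α]
        exact dif_pos h
      rw [hfα]
      exact h.choose_spec
  exact ⟨f, fun α hα => (key α hα).1, fun β α hβ hα => (key α hα).2 β hβ⟩

/-! ### Saturation of a pseudofinite order with a tree -/

/-- A linear order `X` with a tree `T` of sequences of elements of `X`, indexed by proper initial
segments of `X`, and a family of "definable" subsets of `X`. `val t m` is meaningful only for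
`m < len t`. Sequences of length below `bound` can be prolonged, and all sequences can be cut down
to any length up to `bound`. -/
structure CodedTree (X T : Type u) [LinearOrder X] where
  len : T → X
  val : T → X → X
  IsDef : Set X → Prop
  bound : X
  exists_len_isBot : ∃ t, IsBot (len t)
  exists_concat : ∀ t x, len t < bound →
    ∃ t', len t ⋖ len t' ∧ val t' (len t) = x ∧ ∀ m < len t, val t' m = val t m
  exists_restrict : ∀ t n, n ≤ len t → n ≤ bound →
    ∃ t', len t' = n ∧ ∀ m < n, val t' m = val t m
  exists_covBy : ∀ n : X, ¬ IsBot n → ∃ m, m ⋖ n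
  /-- Pseudofiniteness: from `n₀` on, there is a last point up to which `t` stays in `D`. -/
  exists_last : ∀ D, IsDef D → ∀ t n₀, n₀ ≤ len t →
    ∃ e, n₀ ≤ e ∧ (∀ m, n₀ ≤ m → m < e → val t m ∈ D) ∧
      ∀ n, n₀ ≤ n → n ≤ len t → (∀ m, n₀ ≤ m → m < n → val t m ∈ D) → n ≤ e
  infinite_Iic_bound : (Set.Iic bound).Infinite

namespace CodedTree

variable {X T : Type u} [LinearOrder X] (S : CodedTree X T)

/-- `t` is an initial segment of `t'`. -/
def Ext (t t' : T) : Prop := S.len t ≤ S.len t' ∧ ∀ m < S.len t, S.val t m = S.val t' m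

/-- The iterated predecessors of the bound. -/
theorem exists_descending_seq :
    ∃ c : ℕ → X, c 0 = S.bound ∧ (∀ k, c (k + 1) ⋖ c k) ∧ ∀ k, ¬ IsBot (c k) := by
  have hnb : ∀ x : X, (Set.Iic x).Infinite → ¬ IsBot x := by
    intro x hx hb
    refine hx ((Set.finite_singleton x).subset fun y hy => ?_)
    exact le_antisymm hy (hb y)
  have step : ∀ x : {x : X // (Set.Iic x).Infinite}, ∃ y : {x : X // (Set.Iic x).Infinite},
      y.1 ⋖ x.1 := by
    rintro ⟨x, hx⟩
    obtain ⟨m, hm⟩ := S.exists_covBy x (hnb x hx)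
    refine ⟨⟨m, fun hfin => hx ((hfin.insert x).subset fun y hy => ?_)⟩, hm⟩
    rcases eq_or_lt_of_le (show y ≤ x from hy) with h | h
    · exact Or.inl h
    · exact Or.inr (hm.le_of_lt h)
  choose g hg using step
  let c : ℕ → {x : X // (Set.Iic x).Infinite} := fun k =>
    Nat.rec ⟨S.bound, S.infinite_Iic_bound⟩ (fun _ x => g x) k
  exact ⟨fun k => (c k).1, rfl, fun k => hg (c k), fun k => hnb _ (c k).2⟩

/-- If small pre-cuts of `X` are filled and small branches of the tree have upper bounds, then a
small family of definable subsets of `X` with the finite intersection property has a common point: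
it is a late value of a long sequence in the tree whose values eventually stay in each of the given
sets. -/
theorem sInter_nonempty {κ : Cardinal.{u}} (hκ : ℵ₀ ≤ κ)
    (hcut : ∀ A B : Set X, #A ≤ κ → #B ≤ κ → A.Nonempty → B.Nonempty →
      (∀ x ∈ A, ∃ y ∈ A, x < y) → (∀ x ∈ A, ∀ y ∈ B, x < y) →
      ∃ n, (∀ x ∈ A, x < n) ∧ ∀ y ∈ B, n ≤ y)
    (hpath : ∀ C : Set T, #C ≤ κ → (∀ t ∈ C, ∀ t' ∈ C, S.Ext t t' ∨ S.Ext t' t) → C.Nonempty →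
      (∀ t ∈ C, ∃ t' ∈ C, S.len t < S.len t') → ∃ t, ∀ t' ∈ C, S.Ext t' t)
    (𝓕 : Set (Set X)) (h𝓕 : #𝓕 ≤ κ) (hdef : ∀ D ∈ 𝓕, S.IsDef D)
    (hfip : ∀ 𝓖 ⊆ 𝓕, 𝓖.Finite → (⋂₀ 𝓖).Nonempty) : (⋂₀ 𝓕).Nonempty := by
  induction hμ : #𝓕 using WellFoundedLT.induction generalizing 𝓕 with
  | ind μ ih =>
  subst hμ
  rcases lt_or_ge (#𝓕) ℵ₀ with hfin | hinf
  · exact hfip 𝓕 subset_rfl (Cardinal.lt_aleph0_iff_set_finite.1 hfin)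
  have hne : 𝓕.Nonempty := by
    rw [Set.nonempty_iff_ne_empty]
    rintro rfl
    simp [aleph0_ne_zero] at hinf
  obtain ⟨e, he⟩ := Cardinal.exists_image_Iio_ord_eq 𝓕 hne
  have hlim := Cardinal.isSuccLimit_ord hinf
  have hmem : ∀ α < (#𝓕).ord, e α ∈ 𝓕 := fun α hα => he ▸ Set.mem_image_of_mem e hα
  -- the smaller families have common points, by the induction hypothesis
  have hb : ∀ α < (#𝓕).ord, ∃ b, ∀ β ≤ α, b ∈ e β := by
    intro α hα
    have hα' : Order.succ α < (#𝓕).ord := hlim.succ_lt hα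
    have hsub : e '' Set.Iio (Order.succ α) ⊆ 𝓕 := by
      rintro _ ⟨β, hβ, rfl⟩
      exact hmem β (lt_trans hβ hα')
    have hlt : #(e '' Set.Iio (Order.succ α)) < #𝓕 :=
      (Cardinal.mk_image_Iio_ordinal_le _ _).trans_lt (lt_ord.1 hα')
    obtain ⟨b, hb⟩ := ih _ hlt _ (hlt.le.trans h𝓕) (fun D hD => hdef D (hsub hD))
      (fun 𝓖 h𝓖 => hfip 𝓖 (h𝓖.trans hsub)) rfl
    exact ⟨b, fun β hβ => hb _ ⟨β, Order.lt_succ_iff.2 hβ, rfl⟩⟩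
  obtain ⟨c, hc0, hc, hcbot⟩ := S.exists_descending_seq
  have : Nonempty T := S.exists_len_isBot.nonempty
  obtain ⟨f, hP, hR⟩ := exists_ordinal_seq (#𝓕).ord
    (fun _ t => ∀ k, S.len t < c k)
    (fun β s _ t => S.len s < S.len t ∧ (∀ m < S.len s, S.val s m = S.val t m) ∧
      ∀ m, S.len s ≤ m → m < S.len t → S.val t m ∈ e β) (by
    intro α hα f hP hR
    rcases Ordinal.zero_or_succ_or_isSuccLimit α with rfl | ⟨β, rfl⟩ | hl
    · obtain ⟨t, ht⟩ := S.exists_len_isBot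
      exact ⟨t, fun k => (ht _).trans_lt (hc k).lt, fun β hβ => absurd hβ (not_lt_zero)⟩
    · have hββ : β < Order.succ β := Order.lt_succ β
      have hβ : β < (#𝓕).ord := hββ.trans_le hα
      obtain ⟨b, hb⟩ := hb β hβ
      obtain ⟨t, hcov, hval, hold⟩ := S.exists_concat (f β) b (hc0 ▸ hP β hββ 0)
      have hstep : ∀ m, m < S.len t → m < S.len (f β) ∨ m = S.len (f β) := fun m hm =>
        (hcov.le_of_lt hm).lt_or_eq
      refine ⟨t, fun k => ?_, fun γ hγ => ?_⟩
      · exact (le_of_not_gt fun h => hcov.2 (hP β hββ (k + 1)) h).trans_lt (hc k).lt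
      · rcases (Order.lt_succ_iff.1 hγ).eq_or_lt with rfl | hγβ
        · refine ⟨hcov.lt, fun m hm => (hold m hm).symm, fun m hm hmt => ?_⟩
          rcases hstep m hmt with h | rfl
          · exact absurd h hm.not_gt
          · rw [hval]
            exact hb _ le_rfl
        · obtain ⟨h1, h2, h3⟩ := hR γ β hγβ hββ
          refine ⟨h1.trans hcov.lt, fun m hm => ?_, fun m hm hmt => ?_⟩
          · rw [h2 m hm, hold m (hm.trans h1)]
          · rcases hstep m hmt with h | rfl
            · rw [hold m h]
              exact h3 m hm h
            · rw [hval]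
              exact hb _ hγβ.le
    · have hcard : α.card ≤ κ := by
        refine le_trans ?_ h𝓕
        simpa using Ordinal.card_le_card hα
      have h0 : 0 < α := hl.bot_lt
      -- An upper bound of the sequence constructed so far
      obtain ⟨t, ht⟩ : ∃ t, ∀ t' ∈ f '' Set.Iio α, S.Ext t' t := by
        refine hpath _ ((Cardinal.mk_image_Iio_ordinal_le _ _).trans hcard) ?_ ⟨_, 0, h0, rfl⟩ ?_
        · rintro _ ⟨β, hβ, rfl⟩ _ ⟨γ, hγ, rfl⟩
          rcases lt_trichotomy β γ with h | rfl | h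
          · exact Or.inl ⟨(hR _ _ h hγ).1.le, (hR _ _ h hγ).2.1⟩
          · exact Or.inl ⟨le_rfl, fun _ _ => rfl⟩
          · exact Or.inr ⟨(hR _ _ h hβ).1.le, (hR _ _ h hβ).2.1⟩
        · rintro _ ⟨β, hβ, rfl⟩
          exact ⟨_, ⟨_, hl.succ_lt hβ, rfl⟩, (hR _ _ (Order.lt_succ β) (hl.succ_lt hβ)).1⟩
      have ht' : ∀ β < α, S.Ext (f β) t := fun β hβ => ht _ ⟨β, hβ, rfl⟩
      -- the last point up to which `t`, from `len (f β)` on, stays in `e β`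
      have hlast : ∀ β, ∃ x, β < α → S.len (f β) ≤ x ∧
          (∀ m, S.len (f β) ≤ m → m < x → S.val t m ∈ e β) ∧
          ∀ n, S.len (f β) ≤ n → n ≤ S.len t →
            (∀ m, S.len (f β) ≤ m → m < n → S.val t m ∈ e β) → n ≤ x := by
        intro β
        by_cases hβ : β < α
        · obtain ⟨x, hx⟩ := S.exists_last (e β) (hdef _ (hmem β (hβ.trans_le hα))) t _ (ht' β hβ).1
          exact ⟨x, fun _ => hx⟩
        · exact ⟨S.bound, fun h => absurd h hβ⟩
      choose g hg using hlast
      have hlt : ∀ β < α, ∀ γ < α, S.len (f γ) ≤ g β := by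
        intro β hβ γ hγ
        rcases le_or_gt γ β with h | h
        · refine le_trans ?_ (hg β hβ).1
          rcases h.eq_or_lt with rfl | h
          · exact le_rfl
          · exact (hR _ _ h hβ).1.le
        · refine (hg β hβ).2.2 _ (hR _ _ h hγ).1.le (ht' γ hγ).1 fun m hm hmγ => ?_
          rw [← (ht' γ hγ).2 m hmγ]
          exact (hR _ _ h hγ).2.2 m hm hmγ
      obtain ⟨n, hn1, hn2⟩ := hcut ((fun β => S.len (f β)) '' Set.Iio α)
        (g '' Set.Iio α ∪ Set.range c ∪ {S.len t})
        ((Cardinal.mk_image_Iio_ordinal_le _ _).trans hcard)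
        (by
          refine (mk_union_le _ _).trans (add_le_of_le hκ ((mk_union_le _ _).trans
            (add_le_of_le hκ ((Cardinal.mk_image_Iio_ordinal_le _ _).trans hcard) ?_)) ?_)
          · refine le_trans ?_ hκ
            exact Cardinal.mk_le_aleph0_iff.2 (Set.countable_range c).to_subtype
          · rw [mk_singleton]
            exact one_le_aleph0.trans hκ)
        ⟨_, 0, h0, rfl⟩ ⟨_, Or.inr rfl⟩
        (by
          rintro _ ⟨β, hβ, rfl⟩
          exact ⟨_, ⟨_, hl.succ_lt hβ, rfl⟩, (hR _ _ (Order.lt_succ β) (hl.succ_lt hβ)).1⟩)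
        (by
          rintro _ ⟨γ, hγ, rfl⟩ y hy
          have hγ' : S.len (f γ) < S.len (f (Order.succ γ)) :=
            (hR _ _ (Order.lt_succ γ) (hl.succ_lt hγ)).1
          rcases hy with (⟨β, hβ, rfl⟩ | ⟨k, rfl⟩) | rfl
          · exact hγ'.trans_le (hlt β hβ _ (hl.succ_lt hγ))
          · exact hP γ hγ k
          · exact hγ'.trans_le (ht' _ (hl.succ_lt hγ)).1)
      have hnc : ∀ k, n ≤ c k := fun k => hn2 _ (Or.inl (Or.inr ⟨k, rfl⟩))
      obtain ⟨s, hs, hst⟩ := S.exists_restrict t n (hn2 _ (Or.inr rfl)) (hc0 ▸ hnc 0)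
      refine ⟨s, fun k => hs ▸ (hnc (k + 1)).trans_lt (hc k).lt, fun β hβ => ?_⟩
      have hβn : S.len (f β) < n := hn1 _ ⟨β, hβ, rfl⟩
      rw [hs]
      refine ⟨hβn, fun m hm => ?_, fun m hm hmn => ?_⟩
      · rw [hst m (hm.trans hβn)]
        exact (ht' β hβ).2 m hm
      · rw [hst m hmn]
        exact (hg β hβ).2.1 m hm (hmn.trans_le (hn2 _ (Or.inl (Or.inl ⟨β, hβ, rfl⟩)))))
  -- the last value of the last sequence lies in all sets
  set t := f (#𝓕).ord with htdef
  have hpos : 0 < (#𝓕).ord := hlim.bot_lt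
  obtain ⟨m, hm⟩ := S.exists_covBy (S.len t) fun h =>
    (h _).not_gt (hR 0 _ hpos le_rfl).1
  refine ⟨S.val t m, fun D hD => ?_⟩
  have hD' : D ∈ e '' Set.Iio (#𝓕).ord := by rwa [he]
  obtain ⟨β, hβ, rfl⟩ := hD'
  exact (hR β _ hβ le_rfl).2.2 m (hm.le_of_lt (hR β _ hβ le_rfl).1) hm.lt

end CodedTree

/-! ### Definability with parameters -/

namespace Set

variable {M : Type u} {L : FirstOrder.Language.{u₁, v₁}} [L.Structure M] {α β γ : Type*}
  {A : Set M}

theorem definable_realize (φ : L.Formula α) : A.Definable L {v | φ.Realize v} :=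
  Definable.mono (empty_definable_iff.2 ⟨φ, rfl⟩) (empty_subset A)

theorem Definable.and {P Q : (α → M) → Prop} (hP : A.Definable L {v | P v})
    (hQ : A.Definable L {v | Q v}) : A.Definable L {v | P v ∧ Q v} :=
  hP.inter hQ

theorem Definable.not {P : (α → M) → Prop} (hP : A.Definable L {v | P v}) :
    A.Definable L {v | ¬ P v} :=
  hP.compl

theorem Definable.imp {P Q : (α → M) → Prop} (hP : A.Definable L {v | P v})
    (hQ : A.Definable L {v | Q v}) : A.Definable L {v | P v → Q v} := by
  simpa only [imp_iff_not_or] using! hP.compl.union hQ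

theorem Definable.forall_tuple [Finite β] {P : (α → M) → (β → M) → Prop}
    (h : A.Definable L {w : α ⊕ β → M | P (w ∘ Sum.inl) (w ∘ Sum.inr)}) :
    A.Definable L {v | ∀ u, P v u} := by
  simpa using! h.forall_of_finite

theorem Definable.exists_tuple [Finite β] {P : (α → M) → (β → M) → Prop}
    (h : A.Definable L {w : α ⊕ β → M | P (w ∘ Sum.inl) (w ∘ Sum.inr)}) :
    A.Definable L {v | ∃ u, P v u} := by
  simpa using! h.exists_of_finite

theorem Definable.comp_map [Finite β] {P : (β → M) → Prop} (h : A.Definable L {v | P v})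
    {F : (α → M) → β → M} (hF : A.DefinableMap L F) : A.Definable L {v | P (F v)} :=
  h.preimage_map hF

theorem definableMap_comp (σ : β → α) : A.DefinableMap L (fun v : α → M => v ∘ σ) :=
  fun _ => DefinableFun.proj L

theorem definableMap_const (c : β → M) :
    (univ : Set M).DefinableMap L (fun _ : α → M => c) :=
  fun _ => definableFun_const L _ (mem_univ _)

theorem DefinableMap.sumElim {F : (α → M) → β → M} {G : (α → M) → γ → M}
    (hF : A.DefinableMap L F) (hG : A.DefinableMap L G) :
    A.DefinableMap L (fun v => Sum.elim (F v) (G v)) := by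
  rintro (i | i)
  · exact hF i
  · exact hG i

end Set

/-! ### Definable relations and the linear order on `X_a` -/

namespace DefOrder

variable {L : FirstOrder.Language.{u₁, v₁}} {L' : FirstOrder.Language.{u₂, v₂}} {N : Type u}
  [L'.Structure N] {a : DefOrder L N}

section TreeDefinability

variable {α : Type*}

variable {τ : TreeFormulas L' a.form}

theorem definable_mem_tree {F : (α → N) → Fin τ.nt → N}
    (hF : (Set.univ : Set N).DefinableMap L' F) :
    (Set.univ : Set N).Definable L' {v | F v ∈ a.Tree τ} :=
  (Set.definable_realize τ.mem).comp_map
    (hF.sumElim ((Set.definableMap_const _).sumElim (Set.definableMap_const _)))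

theorem definable_lgn {F : (α → N) → Fin τ.nt → N} {G : (α → N) → a.Pt}
    (hF : (Set.univ : Set N).DefinableMap L' F) (hG : (Set.univ : Set N).DefinableMap L' G) :
    (Set.univ : Set N).Definable L' {v | a.Lgn τ (F v) (G v)} :=
  (Set.definable_realize τ.lgn).comp_map
    ((hF.sumElim hG).sumElim ((Set.definableMap_const _).sumElim (Set.definableMap_const _)))

theorem definable_val {F : (α → N) → Fin τ.nt → N} {G H : (α → N) → a.Pt}
    (hF : (Set.univ : Set N).DefinableMap L' F) (hG : (Set.univ : Set N).DefinableMap L' G)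
    (hH : (Set.univ : Set N).DefinableMap L' H) :
    (Set.univ : Set N).Definable L' {v | a.Val τ (F v) (G v) (H v)} :=
  (Set.definable_realize τ.val).comp_map
    ((hF.sumElim (hG.sumElim hH)).sumElim
      ((Set.definableMap_const _).sumElim (Set.definableMap_const _)))

theorem definable_treeLe {F G : (α → N) → Fin τ.nt → N}
    (hF : (Set.univ : Set N).DefinableMap L' F) (hG : (Set.univ : Set N).DefinableMap L' G) :
    (Set.univ : Set N).Definable L' {v | a.TreeLe τ (F v) (G v)} :=
  (Set.definable_realize τ.le).comp_map
    ((hF.sumElim hG).sumElim ((Set.definableMap_const _).sumElim (Set.definableMap_const _)))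

end TreeDefinability

variable [L.Structure N]

/-- The linear order `≤_a` on the type of elements of `X_a`. -/
@[reducible]
noncomputable def linearOrder (h : a.form.IsPseudofiniteOrder L' a.par) : LinearOrder a.X where
  le x y := a.le x y
  le_refl x := x.2
  le_trans x y z hxy hyz := h.trans x x.2 y y.2 z z.2 hxy hyz
  le_antisymm x y hxy hyx := Subtype.ext (h.antisymm x x.2 y y.2 hxy hyx)
  le_total x y := h.total x x.2 y y.2
  toDecidableLE := Classical.decRel _

section LinearOrder

variable (h : a.form.IsPseudofiniteOrder L' a.par)

theorem linearOrder_lt_iff (x y : a.X) :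
    letI := linearOrder h
    x < y ↔ a.lt x y := by
  let _ := linearOrder h
  rw [lt_iff_le_and_ne, Ne, Subtype.ext_iff]
  rfl

theorem linearOrder_covBy_of_isSucc {x y : a.X} (hxy : a.IsSucc x y) :
    letI := linearOrder h
    x ⋖ y := by
  let _ := linearOrder h
  refine ⟨(linearOrder_lt_iff h x y).2 hxy.2.2.1, fun z hxz hzy => ?_⟩
  exact hzy.not_ge (hxy.2.2.2 z z.2 ((linearOrder_lt_iff h x z).1 hxz))

theorem linearOrder_exists_covBy (x : a.X) :
    letI := linearOrder h
    ¬ IsBot x → ∃ y, y ⋖ x := by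
  let _ := linearOrder h
  intro hx
  simp only [IsBot, not_forall, not_le] at hx
  obtain ⟨z, hz⟩ := hx
  obtain ⟨y, hy, hyx, hmax⟩ := h.exists_pred x x.2 ⟨z, z.2, (linearOrder_lt_iff h z x).1 hz⟩
  refine ⟨⟨y, hy⟩, (linearOrder_lt_iff h ⟨y, hy⟩ x).2 hyx, fun w hyw hwx => ?_⟩
  exact hyw.not_ge (hmax w w.2 ((linearOrder_lt_iff h w x).1 hwx))

theorem linearOrder_pseudofinite (D : Set a.X) (hne : D.Nonempty)
    (hD : (Set.univ : Set N).Definable L' (Subtype.val '' D)) :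
    letI := linearOrder h
    BddAbove D → (∃ m, IsGreatest D m) ∧ ∃ m, IsLeast D m := by
  let _ := linearOrder h
  rintro ⟨b, hb⟩
  have hsub : Subtype.val '' D ⊆ a.X := by
    rintro _ ⟨x, -, rfl⟩
    exact x.2
  obtain ⟨⟨m, ⟨m, hm, rfl⟩, hmax⟩, ⟨k, ⟨k, hk, rfl⟩, hmin⟩⟩ := h.pseudofinite _ hsub (hne.image _) hD
    ⟨b, b.2, by rintro _ ⟨x, hx, rfl⟩; exact hb hx⟩
  exact ⟨⟨m, hm, fun x hx => hmax _ ⟨x, hx, rfl⟩⟩, ⟨k, hk, fun x hx => hmin _ ⟨x, hx, rfl⟩⟩⟩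

end LinearOrder

section Definability

variable {α : Type*}

theorem definable_le (ι : L →ᴸ L') [ι.IsExpansionOn N] {F G : (α → N) → a.Pt}
    (hF : (Set.univ : Set N).DefinableMap L' F) (hG : (Set.univ : Set N).DefinableMap L' G) :
    (Set.univ : Set N).Definable L' {v | a.le (F v) (G v)} :=
  ((Set.definable_realize a.form.formula).map_expansion ι).comp_map
    ((hF.sumElim hG).sumElim (Set.definableMap_const _))

theorem definable_mem_X (ι : L →ᴸ L') [ι.IsExpansionOn N] {F : (α → N) → a.Pt}
    (hF : (Set.univ : Set N).DefinableMap L' F) :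
    (Set.univ : Set N).Definable L' {v | F v ∈ a.X} :=
  definable_le ι hF hF

end Definability

end DefOrder

namespace DefOrder

variable {L : FirstOrder.Language.{u₁, v₁}} {L' : FirstOrder.Language.{u₂, v₂}} {N : Type u}
  [L.Structure N] [L'.Structure N] {a : DefOrder L N}

/-! ### The tree of a definable order as a coded tree -/

namespace IsTree

variable {τ : TreeFormulas L' a.form}

/-- The length of an element of `𝒯_a`. -/
noncomputable def len (hτ : a.IsTree τ) (t : a.Tree τ) : a.X :=
  ⟨(hτ.lgn_unique t t.2).choose,
    hτ.lgn_mem t t.2 _ (hτ.lgn_unique t t.2).choose_spec.1⟩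

theorem lgn_len (hτ : a.IsTree τ) (t : a.Tree τ) : a.Lgn τ t (hτ.len t) :=
  (hτ.lgn_unique t t.2).choose_spec.1

theorem len_eq_of_lgn (hτ : a.IsTree τ) (t : a.Tree τ) (x : a.X) (hx : a.Lgn τ t x) :
    hτ.len t = x :=
  Subtype.ext ((hτ.lgn_unique t t.2).unique (hτ.lgn_len t) hx)

open Classical in
/-- The value of an element of `𝒯_a` at `m`, and `m` itself beyond the length. -/
noncomputable def val (hτ : a.IsTree τ) (t : a.Tree τ) (m : a.X) : a.X :=
  if hm : a.lt m (hτ.len t) then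
    ⟨(hτ.val_unique t t.2 _ (hτ.lgn_len t) m m.2 hm).choose,
      hτ.val_mem t t.2 _ (hτ.lgn_len t) m m.2 hm _
        (hτ.val_unique t t.2 _ (hτ.lgn_len t) m m.2 hm).choose_spec.1⟩
  else m

theorem val_iff (hτ : a.IsTree τ) (t : a.Tree τ) (m : a.X) (hm : a.lt m (hτ.len t)) (y : a.Pt) :
    a.Val τ t m y ↔ (hτ.val t m : a.Pt) = y := by
  have hu := hτ.val_unique t t.2 _ (hτ.lgn_len t) m m.2 hm
  have hv : (hτ.val t m : a.Pt) = hu.choose := by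
    simp [val, hm]
  rw [hv]
  exact ⟨fun hy => hu.unique hu.choose_spec.1 hy, fun hy => hy ▸ hu.choose_spec.1⟩

theorem treeLe_iff_val (hτ : a.IsTree τ) (h : a.form.IsPseudofiniteOrder L' a.par)
    (t t' : a.Tree τ) :
    letI := linearOrder h
    a.TreeLe τ t t' ↔ hτ.len t ≤ hτ.len t' ∧ ∀ m < hτ.len t, hτ.val t m = hτ.val t' m := by
  let _ := linearOrder h
  rw [hτ.treeLe_iff t t.2 t' t'.2 _ _ (hτ.lgn_len t) (hτ.lgn_len t')]
  refine and_congr_right fun hle => ⟨fun H m hm => ?_, fun H m hmX hm y => ?_⟩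
  · have hm1 := (linearOrder_lt_iff h m _).1 hm
    have hm2 := (linearOrder_lt_iff h m _).1 (hm.trans_le hle)
    exact Subtype.ext (((hτ.val_iff t' m hm2 _).1
      ((H m m.2 hm1 _).1 ((hτ.val_iff t m hm1 _).2 rfl))).symm)
  · have hlt := (linearOrder_lt_iff h ⟨m, hmX⟩ _).2 hm
    have hm2 := (linearOrder_lt_iff h ⟨m, hmX⟩ _).1 (hlt.trans_le hle)
    rw [hτ.val_iff t ⟨m, hmX⟩ hm y, hτ.val_iff t' ⟨m, hmX⟩ hm2 y, H _ hlt]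

theorem exists_concat_val (hτ : a.IsTree τ) (h : a.form.IsPseudofiniteOrder L' a.par)
    (t : a.Tree τ) (x : a.X) (hlt : a.lt (hτ.len t) a.desig) :
    letI := linearOrder h
    ∃ t', hτ.len t ⋖ hτ.len t' ∧ hτ.val t' (hτ.len t) = x ∧
      ∀ m < hτ.len t, hτ.val t' m = hτ.val t m := by
  let _ := linearOrder h
  obtain ⟨t', ht', ⟨n', hn', hs⟩, hv, hold⟩ := hτ.concat t t.2 _ (hτ.lgn_len t) hlt x x.2
  have hlen : hτ.len ⟨t', ht'⟩ = ⟨n', hs.2.1⟩ := hτ.len_eq_of_lgn ⟨t', ht'⟩ ⟨n', hs.2.1⟩ hn'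
  have hcov : hτ.len t ⋖ hτ.len ⟨t', ht'⟩ := by
    rw [hlen]
    exact linearOrder_covBy_of_isSucc h hs
  have hlt' : ∀ m, m ≤ hτ.len t → a.lt m (hτ.len ⟨t', ht'⟩) := fun m hm =>
    (linearOrder_lt_iff h _ _).1 (hm.trans_lt hcov.lt)
  refine ⟨⟨t', ht'⟩, hcov, Subtype.ext ((hτ.val_iff _ _ (hlt' _ le_rfl) _).1 hv), fun m hm => ?_⟩
  have hm1 := (linearOrder_lt_iff h m _).1 hm
  exact Subtype.ext ((hτ.val_iff ⟨t', ht'⟩ m (hlt' m hm.le) _).1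
    ((hold m m.2 hm1 _).2 ((hτ.val_iff t m hm1 _).2 rfl)))

/-- The points up to which `t` stays in `D` form a definable set. -/
theorem definable_stays (hτ : a.IsTree τ) (ι : L →ᴸ L') [ι.IsExpansionOn N]
    (h : a.form.IsPseudofiniteOrder L' a.par) (D : Set a.X)
    (hD : (Set.univ : Set N).Definable L' (Subtype.val '' D)) (t : a.Tree τ) (n₀ : a.X) :
    letI := linearOrder h
    (Set.univ : Set N).Definable L' (Subtype.val '' {n : a.X | n₀ ≤ n ∧ n ≤ hτ.len t ∧
      ∀ m, n₀ ≤ m → m < n → hτ.val t m ∈ D}) := by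
  let _ := linearOrder h
  have hdef : (Set.univ : Set N).Definable L' {n : a.Pt | n ∈ a.X ∧ a.le n₀ n ∧
      a.le n (hτ.len t) ∧ ∀ m : a.Pt, m ∈ a.X → a.le n₀ m → ¬ a.le n m →
        ∀ y : a.Pt, a.Val τ t m y → y ∈ Subtype.val '' D} := by
    refine (definable_mem_X ι (Set.definableMap_comp id)).and
      ((definable_le ι (Set.definableMap_const _) (Set.definableMap_comp id)).and
      ((definable_le ι (Set.definableMap_comp id) (Set.definableMap_const _)).and
      (Set.Definable.forall_tuple ?_)))
    refine (definable_mem_X ι (Set.definableMap_comp _)).imp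
      ((definable_le ι (Set.definableMap_const _) (Set.definableMap_comp _)).imp
      ((definable_le ι (Set.definableMap_comp _) (Set.definableMap_comp _)).not.imp
      (Set.Definable.forall_tuple ?_)))
    exact (definable_val (Set.definableMap_const _)
      (Set.definableMap_comp (fun i => Sum.inl (Sum.inr i))) (Set.definableMap_comp Sum.inr)).imp
      (Set.Definable.comp_map hD (Set.definableMap_comp _))
  convert hdef using 1
  ext n
  constructor
  · rintro ⟨n, ⟨h1, h2, h3⟩, rfl⟩
    refine ⟨n.2, h1, h2, fun m hm hnm hmn y hy => ?_⟩
    have hlt : (⟨m, hm⟩ : a.X) < n := not_le.1 hmn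
    refine ⟨hτ.val t ⟨m, hm⟩, h3 ⟨m, hm⟩ hnm hlt, ?_⟩
    exact (hτ.val_iff t ⟨m, hm⟩ ((linearOrder_lt_iff h _ _).1 (hlt.trans_le h2)) y).1 hy
  · rintro ⟨hn, h1, h2, h3⟩
    refine ⟨⟨n, hn⟩, ⟨h1, h2, fun m hm hmn => ?_⟩, rfl⟩
    have hlt : a.lt m (hτ.len t) :=
      (linearOrder_lt_iff h _ _).1 (hmn.trans_le (b := (⟨n, hn⟩ : a.X)) h2)
    obtain ⟨y, hy, hyv⟩ := h3 m m.2 hm (not_le.2 hmn) _ ((hτ.val_iff t m hlt _).2 rfl)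
    rwa [← Subtype.ext hyv]

/-- By induction along the pseudofinite order, the restrictions of `t` to lengths up to the
designated element belong to the tree. -/
theorem exists_restrict (hτ : a.IsTree τ) (ι : L →ᴸ L') [ι.IsExpansionOn N]
    (h : a.form.IsPseudofiniteOrder L' a.par) (hd : a.desig ∈ a.X) (t : a.Tree τ) (n : a.X) :
    letI := linearOrder h
    n ≤ hτ.len t → n ≤ ⟨a.desig, hd⟩ →
      ∃ t', hτ.len t' = n ∧ ∀ m < n, hτ.val t' m = hτ.val t m := by
  let _ := linearOrder h
  intro hn hnd
  by_contra hno
  -- the definable set of the lengths without a restriction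
  let E : Set a.X := {n | n ≤ hτ.len t ∧ n ≤ ⟨a.desig, hd⟩ ∧
    ¬ ∃ t', hτ.len t' = n ∧ ∀ m < n, hτ.val t' m = hτ.val t m}
  have hE : (Set.univ : Set N).Definable L' (Subtype.val '' E) := by
    have hdef : (Set.univ : Set N).Definable L' {n : a.Pt | n ∈ a.X ∧ a.le n (hτ.len t) ∧
        a.le n a.desig ∧ ¬ ∃ t' : Fin τ.nt → N, t' ∈ a.Tree τ ∧ a.Lgn τ t' n ∧
          a.TreeLe τ t' t} := by
      refine (definable_mem_X ι (Set.definableMap_comp id)).and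
        ((definable_le ι (Set.definableMap_comp id) (Set.definableMap_const _)).and
        ((definable_le ι (Set.definableMap_comp id) (Set.definableMap_const _)).and
        (Set.Definable.exists_tuple ?_).not))
      exact (definable_mem_tree (Set.definableMap_comp _)).and
        ((definable_lgn (Set.definableMap_comp _) (Set.definableMap_comp _)).and
        (definable_treeLe (Set.definableMap_comp _) (Set.definableMap_const _)))
    convert hdef using 1
    have key : ∀ n : a.X, n ≤ hτ.len t →
        ((∃ t', hτ.len t' = n ∧ ∀ m < n, hτ.val t' m = hτ.val t m) ↔
          ∃ t' : Fin τ.nt → N, t' ∈ a.Tree τ ∧ a.Lgn τ t' n ∧ a.TreeLe τ t' t) := by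
      intro n hn
      constructor
      · rintro ⟨t', rfl, hv⟩
        exact ⟨t', t'.2, hτ.lgn_len t', (hτ.treeLe_iff_val h t' t).2 ⟨hn, hv⟩⟩
      · rintro ⟨t', ht', hl, hle⟩
        have hlen := hτ.len_eq_of_lgn ⟨t', ht'⟩ n hl
        refine ⟨⟨t', ht'⟩, hlen, ?_⟩
        rw [← hlen]
        exact ((hτ.treeLe_iff_val h ⟨t', ht'⟩ t).1 hle).2
    ext n
    constructor
    · rintro ⟨n, ⟨h1, h2, h3⟩, rfl⟩
      exact ⟨n.2, h1, h2, fun hex => h3 ((key n h1).2 hex)⟩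
    · rintro ⟨hn, h1, h2, h3⟩
      exact ⟨⟨n, hn⟩, ⟨h1, h2, fun hex => h3 ((key ⟨n, hn⟩ h1).1 hex)⟩, rfl⟩
  obtain ⟨-, k, ⟨hk1, hk2, hk3⟩, hkmin⟩ := linearOrder_pseudofinite h E ⟨n, hn, hnd, hno⟩ hE
    ⟨_, fun x hx => hx.1⟩
  by_cases hbot : IsBot k
  · obtain ⟨t₀, ht₀, n₀, hn₀, hz⟩ := hτ.empty_mem
    refine hk3 ⟨⟨t₀, ht₀⟩, ?_, fun m hm => absurd (hbot m) hm.not_ge⟩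
    have hlen := hτ.len_eq_of_lgn ⟨t₀, ht₀⟩ ⟨n₀, hz.1⟩ hn₀
    rw [hlen]
    exact le_antisymm (hz.2 k k.2) (hbot _)
  · obtain ⟨j, hj⟩ := linearOrder_exists_covBy h k hbot
    have hjE : ∃ t', hτ.len t' = j ∧ ∀ m < j, hτ.val t' m = hτ.val t m := by
      by_contra hjno
      exact hj.lt.not_ge (hkmin ⟨hj.lt.le.trans hk1, hj.lt.le.trans hk2, hjno⟩)
    obtain ⟨s, rfl, hs⟩ := hjE
    obtain ⟨s', hcov, hv, hold⟩ := hτ.exists_concat_val h s (hτ.val t (hτ.len s))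
      ((linearOrder_lt_iff h _ ⟨a.desig, hd⟩).1 (hj.lt.trans_le hk2))
    have hlen : hτ.len s' = k :=
      le_antisymm (le_of_not_gt fun hlt => hcov.2 hj.lt hlt) (le_of_not_gt fun hlt => hj.2 hcov.lt hlt)
    refine hk3 ⟨s', hlen, fun m hm => ?_⟩
    rcases (hj.le_of_lt hm).lt_or_eq with hm' | rfl
    · rw [hold m hm', hs m hm']
    · exact hv

/-- The order and the tree of a nontrivial `a`, with the sets definable with parameters. -/
noncomputable def codedTree (hτ : a.IsTree τ) (ι : L →ᴸ L') [ι.IsExpansionOn N]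
    (h : a.form.IsPseudofiniteOrder L' a.par) (hd : a.desig ∈ a.X) (hnt : a.IsNontrivial) :
    letI := linearOrder h
    CodedTree a.X (a.Tree τ) :=
  letI := linearOrder h
  { len := hτ.len
    val := hτ.val
    IsDef := fun D => (Set.univ : Set N).Definable L' (Subtype.val '' D)
    bound := ⟨a.desig, hd⟩
    exists_len_isBot := by
      obtain ⟨t₀, ht₀, n₀, hn₀, hz⟩ := hτ.empty_mem
      refine ⟨⟨t₀, ht₀⟩, fun x => ?_⟩
      rw [hτ.len_eq_of_lgn ⟨t₀, ht₀⟩ ⟨n₀, hz.1⟩ hn₀]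
      exact hz.2 x x.2
    exists_concat := fun t x hlt =>
      hτ.exists_concat_val h t x ((linearOrder_lt_iff h _ ⟨a.desig, hd⟩).1 hlt)
    exists_restrict := hτ.exists_restrict ι h hd
    exists_covBy := linearOrder_exists_covBy h
    exists_last := by
      intro D hD t n₀ hn₀
      obtain ⟨⟨e, ⟨he1, he2, he3⟩, hmax⟩, -⟩ := linearOrder_pseudofinite h
        {n | n₀ ≤ n ∧ n ≤ hτ.len t ∧ ∀ m, n₀ ≤ m → m < n → hτ.val t m ∈ D}
        ⟨n₀, le_rfl, hn₀, fun m hm hm' => absurd hm hm'.not_ge⟩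
        (hτ.definable_stays ι h D hD t n₀) ⟨_, fun x hx => hx.2.1⟩
      exact ⟨e, he1, he3, fun n h1 h2 h3 => hmax ⟨h1, h2, h3⟩⟩
    infinite_Iic_bound := by
      intro hfin
      refine hnt ((hfin.image Subtype.val).subset ?_)
      rintro x ⟨hx, hxd⟩
      exact ⟨⟨x, hx⟩, hxd, rfl⟩ }

end IsTree

/-- Saturation of a nontrivial order in a structure without small cuts and small unbounded
branches. -/
theorem sInter_nonempty {τ : TreeFormulas L' a.form} (hτ : a.IsTree τ) (ι : L →ᴸ L')
    [ι.IsExpansionOn N] (h : a.form.IsPseudofiniteOrder L' a.par) (hd : a.desig ∈ a.X)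
    (hnt : a.IsNontrivial) {κ : Cardinal.{u}} (hκ : ℵ₀ ≤ κ)
    (hcut : ∀ κ₁ κ₂ : Cardinal.{u}, κ₁ ≤ κ → κ₂ ≤ κ → ¬ a.HasCut κ₁ κ₂)
    (hpath : ∀ c ≤ κ, ¬ a.HasUnboundedPath τ c)
    (𝓕 : Set (Set a.X)) (h𝓕 : #𝓕 ≤ κ)
    (hdef : ∀ D ∈ 𝓕, (Set.univ : Set N).Definable L' (Subtype.val '' D))
    (hfip : ∀ 𝓖 ⊆ 𝓕, 𝓖.Finite → (⋂₀ 𝓖).Nonempty) : (⋂₀ 𝓕).Nonempty := by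
  let _ := linearOrder h
  refine (hτ.codedTree ι h hd hnt).sInter_nonempty hκ (exists_between_of_regular_seq ?_) ?_ 𝓕 h𝓕
    hdef hfip
  · intro κ₁ κ₂ hr₁ hr₂ hκ₁ hκ₂ f g hf hg hfg
    by_contra hno
    refine hcut κ₁ κ₂ hκ₁ hκ₂ ⟨hr₁, hr₂, fun α => f α, fun β => g β, fun α _ => (f α).2,
      fun β _ => (g β).2, fun α β hαβ hβ => (linearOrder_lt_iff h _ _).1 (hf α β hαβ hβ),
      fun α β hαβ hβ => (linearOrder_lt_iff h _ _).1 (hg α β hαβ hβ),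
      fun α hα β hβ => (linearOrder_lt_iff h _ _).1 (hfg α hα β hβ), ?_⟩
    rintro ⟨x, hx, hx1, hx2⟩
    exact hno ⟨⟨x, hx⟩, fun α hα => (linearOrder_lt_iff h (f α) ⟨x, hx⟩).2 (hx1 α hα),
      fun β hβ => (linearOrder_lt_iff h ⟨x, hx⟩ (g β)).2 (hx2 β hβ)⟩
  · intro C hC hchain hne hmax
    have hext : ∀ t t' : a.Tree τ, (hτ.codedTree ι h hd hnt).Ext t t' ↔ a.TreeLe τ t t' :=
      fun t t' => (hτ.treeLe_iff_val h t t').symm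
    obtain ⟨c, -, hc, f, hf, hmono, hcof⟩ := exists_regular_cofinal_seq (hτ.len '' C)
      (hne.image _) (by
        rintro _ ⟨t, ht, rfl⟩
        obtain ⟨t', ht', hlt⟩ := hmax t ht
        exact ⟨_, ⟨t', ht', rfl⟩, hlt⟩)
    -- elements of `C` of the lengths given by a cofinal sequence
    have hg : ∀ α, ∃ t, α < c.ord → t ∈ C ∧ hτ.len t = f α := by
      intro α
      by_cases hα : α < c.ord
      · obtain ⟨t, ht⟩ := hf α hα
        exact ⟨t, fun _ => ht⟩
      · exact ⟨hne.some, fun hα' => absurd hα' hα⟩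
    choose g hg using hg
    have hle : ∀ t ∈ C, ∀ t' ∈ C, hτ.len t < hτ.len t' → a.TreeLe τ t t' := by
      intro t ht t' ht' hlt
      rw [← hext]
      exact (hchain t ht t' ht').resolve_right fun hE => hlt.not_ge hE.1
    by_contra hno
    refine hpath c (hc.trans (mk_image_le.trans hC)) ⟨fun α => g α, fun α _ => (g α).2, ?_, ?_⟩
    · intro α β hαβ hβ
      have h1 := hg α (hαβ.trans hβ)
      have h2 := hg β hβ
      have hlt : hτ.len (g α) < hτ.len (g β) := by
        rw [h1.2, h2.2]
        exact hmono α β hαβ hβ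
      exact ⟨hle _ h1.1 _ h2.1 hlt, fun heq => hlt.ne (congrArg hτ.len (Subtype.ext heq))⟩
    · rintro ⟨t, ht, hbd⟩
      refine hno ⟨⟨t, ht⟩, fun t' ht' => ?_⟩
      obtain ⟨t'', ht'', hlt⟩ := hmax t' ht'
      obtain ⟨α, hα, hle'⟩ := hcof _ ⟨t'', ht'', rfl⟩
      have h1 := hg α hα
      have h2 := (hext t' (g α)).2 (hle _ ht' _ h1.1 (by rw [h1.2]; exact hlt.trans_le hle'))
      have h3 := (hext (g α) ⟨t, ht⟩).2 (hbd α hα)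
      exact ⟨h2.1.trans h3.1, fun m hm => (h2.2 m hm).trans (h3.2 m (hm.trans_le h2.1))⟩

end DefOrder

/-! ### Realization of types coordinate by coordinate -/

namespace Set

variable {M : Type u} {L : FirstOrder.Language.{u₁, v₁}} [L.Structure M] {α β ι : Type*}
  {A : Set M}

theorem Definable.forall_index [Finite ι] {P : ι → (α → M) → Prop}
    (h : ∀ i, A.Definable L {v | P i v}) : A.Definable L {v | ∀ i, P i v} := by
  rw [ofPred_forall]
  exact definable_iInter_of_finite h

theorem definable_apply_eq (σ τ : α) : A.Definable L {v : α → M | v σ = v τ} :=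
  (DefinableFun.proj L).ofPred_eq (DefinableFun.proj L)

theorem definable_apply_eq_const (σ : α) (m : M) :
    (univ : Set M).Definable L {v : α → M | v σ = m} :=
  (DefinableFun.proj L).ofPred_eq (definableFun_const L _ (mem_univ m))

end Set

/-- A language of size at most `κ` has at most `κ` formulas over `κ` parameters. -/
theorem FirstOrder.Language.lift_mk_formula_withConstants_le
    {L' : FirstOrder.Language.{u₂, v₂}} {N : Type u} {κ : Cardinal.{u}} (hκ : ℵ₀ ≤ κ)
    (hL : Cardinal.lift.{u} L'.card ≤ Cardinal.lift.{max u₂ v₂} κ) {A : Set N} (hA : #A ≤ κ)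
    {V : Type} [Finite V] (p : Set (L'[[A]].Formula V)) :
    Cardinal.lift.{u} #p ≤ Cardinal.lift.{max u u₂ v₂} κ := by
  have h1 : #(L'[[A]].Formula V) ≤ #(Σ n, L'[[A]].BoundedFormula V n) :=
    mk_le_of_injective (f := Sigma.mk (β := fun n => L'[[A]].BoundedFormula V n) 0)
      sigma_mk_injective
  have h2 := (mk_set_le p).trans (h1.trans BoundedFormula.card_le)
  refine (Cardinal.lift_le.2 h2).trans ?_
  have hV : #V ≤ ℵ₀ := mk_le_aleph0
  rw [card_withConstants]
  simp only [Cardinal.lift_max, Cardinal.lift_add, Cardinal.lift_lift, Cardinal.lift_aleph0]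
  have hκ' : ℵ₀ ≤ Cardinal.lift.{max u u₂ v₂} κ := Cardinal.aleph0_le_lift.2 hκ
  refine max_le hκ' (add_le_of_le hκ' ?_ (add_le_of_le hκ' ?_ (Cardinal.lift_le.2 hA)))
  · exact (Cardinal.lift_le_aleph0.2 hV).trans hκ'
  · exact hL.trans_eq (congrFun Cardinal.lift_umax.{u, max u₂ v₂} κ).symm

namespace CofinalitySpectrumProblem

variable {L : FirstOrder.Language.{u₁, v₁}} {L' : FirstOrder.Language.{u₂, v₂}} {ι : L →ᴸ L'}
  {N : Type u} [L.Structure N] [L'.Structure N]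

/-- Saturation of a single order. When `X_a` is finite, so is the family of sets. -/
theorem sInter_nonempty (s : CofinalitySpectrumProblem ι N) {κ : Cardinal.{u}} (hκ : ℵ₀ ≤ κ)
    (hs : (κ : WithTop Cardinal.{u}) < min s.p s.t) {a : DefOrder L N} (ha : a ∈ s.Or)
    (hnf : a.IsNontrivial ∨ a.X.Finite)
    (𝓕 : Set (Set a.X)) (h𝓕 : #𝓕 ≤ κ)
    (hdef : ∀ D ∈ 𝓕, (Set.univ : Set N).Definable L' (Subtype.val '' D))
    (hfip : ∀ 𝓖 ⊆ 𝓕, 𝓖.Finite → (⋂₀ 𝓖).Nonempty) : (⋂₀ 𝓕).Nonempty := by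
  rcases hnf with hnt | hfin
  · have := s.isExpansion
    refine DefOrder.sInter_nonempty (s.isTree a ha) ι (s.isOrder _ (s.form_mem a ha) _)
      (s.desig_mem a ha) hnt hκ ?_ ?_ 𝓕 h𝓕 hdef hfip
    · intro κ₁ κ₂ h₁ h₂ hc
      have hp : s.p ≤ ((κ₁ + κ₂ : Cardinal.{u}) : WithTop Cardinal.{u}) :=
        sInf_le ⟨a, ha, κ₁, κ₂, hc, rfl⟩
      have hlt := (hs.trans_le (min_le_left _ _)).trans_le hp
      exact (WithTop.coe_lt_coe.1 hlt).not_ge (add_le_of_le hκ h₁ h₂)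
    · intro c hc hpath
      have ht : s.t ≤ (c : WithTop Cardinal.{u}) := sInf_le ⟨a, ha, c, hpath, rfl⟩
      have hlt := (hs.trans_le (min_le_right _ _)).trans_le ht
      exact (WithTop.coe_lt_coe.1 hlt).not_ge hc
  · have : Finite a.X := hfin
    exact hfip 𝓕 subset_rfl 𝓕.toFinite

/-- The variables are treated one at a time: once the values of some of them have been chosen so
that the type stays finitely satisfiable, the possible values of another one form a small family of
definable sets with the finite intersection property. -/
theorem exists_assignment (s : CofinalitySpectrumProblem ι N) {κ : Cardinal.{u}} (hκ : ℵ₀ ≤ κ)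
    (hs : (κ : WithTop Cardinal.{u}) < min s.p s.t) {A : Set N} {n : ℕ}
    {a : Fin n → DefOrder L N} {p : Set (L'[[A]].Formula (Σ i : Fin n, Fin (a i).form.nx))}
    (hp : s.IsOrType A a p) (hcard : Cardinal.lift.{u} #p ≤ Cardinal.lift.{max u u₂ v₂} κ)
    (I : Finset (Fin n)) :
    ∃ w : (Σ i : Fin n, Fin (a i).form.nx) → N, ∀ q : Finset p,
      ∃ v : (Σ i : Fin n, Fin (a i).form.nx) → N,
        (∀ φ ∈ q, φ.1.Realize v) ∧ ∀ i : I, ∀ j, v ⟨i, j⟩ = w ⟨i, j⟩ := by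
  classical
  induction I using Finset.induction_on with
  | empty =>
    obtain ⟨w, -⟩ := hp.finitelySatisfiable ∅ (Set.empty_subset _) Set.finite_empty
    refine ⟨w, fun q => ?_⟩
    obtain ⟨v, hv⟩ := hp.finitelySatisfiable (Subtype.val '' (q : Set p))
      (by rintro _ ⟨φ, -, rfl⟩; exact φ.2) (q.finite_toSet.image _)
    exact ⟨v, fun φ hφ => hv _ ⟨φ, hφ, rfl⟩, fun i => absurd i.2 (Finset.notMem_empty _)⟩
  | insert k I hk ih =>
    obtain ⟨w, hw⟩ := ih
    -- the values of the variable `k` compatible with a finite part of the type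
    let D : Finset p → Set (a k).X := fun q => {x | ∃ v : (Σ i : Fin n, Fin (a i).form.nx) → N,
      ((∀ φ ∈ q, φ.1.Realize v) ∧ ∀ i : I, ∀ j, v ⟨i, j⟩ = w ⟨i, j⟩) ∧
        ∀ j, v ⟨k, j⟩ = x.1 j}
    have := s.isExpansion
    have hdef : ∀ q, (Set.univ : Set N).Definable L' (Subtype.val '' D q) := by
      intro q
      have h1 : (Set.univ : Set N).Definable L' {v : (Σ i : Fin n, Fin (a i).form.nx) → N |
          (∀ φ ∈ q, φ.1.Realize v) ∧ ∀ i : I, ∀ j, v ⟨i, j⟩ = w ⟨i, j⟩} := by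
        refine Set.Definable.and ?_ (Set.Definable.forall_index fun i =>
          Set.Definable.forall_index fun j => Set.definable_apply_eq_const _ _)
        have hq : (Set.univ : Set N).Definable L' {v : (Σ i : Fin n, Fin (a i).form.nx) → N |
            ∀ φ : q, φ.1.1.Realize v} :=
          Set.Definable.forall_index fun φ =>
            Set.Definable.mono (A := A) ⟨φ.1.1, rfl⟩ (Set.subset_univ A)
        simpa using hq
      have h2 : (Set.univ : Set N).Definable L' {x : (a k).Pt | x ∈ (a k).X ∧
          ∃ v : (Σ i : Fin n, Fin (a i).form.nx) → N,
            ((∀ φ ∈ q, φ.1.Realize v) ∧ ∀ i : I, ∀ j, v ⟨i, j⟩ = w ⟨i, j⟩) ∧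
              ∀ j, v ⟨k, j⟩ = x j} :=
        (DefOrder.definable_mem_X ι (Set.definableMap_comp id)).and
          (Set.Definable.exists_tuple ((h1.comp_map (Set.definableMap_comp Sum.inr)).and
            (Set.Definable.forall_index fun j => Set.definable_apply_eq _ _)))
      convert h2 using 1
      ext x
      constructor
      · rintro ⟨x, hx, rfl⟩
        exact ⟨x.2, hx⟩
      · rintro ⟨hx, hv⟩
        exact ⟨⟨x, hx⟩, hv, rfl⟩
    have hsmall : #(Set.range D) ≤ κ := by
      have h1 : Cardinal.lift.{max u u₂ v₂} #(Set.range D) ≤ Cardinal.lift.{u} #(Finset p) :=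
        mk_range_le_lift
      have h2 : #(Finset p) ≤ max ℵ₀ #p := by
        rcases finite_or_infinite p with hfin | hinf
        · exact le_max_of_le_left (mk_le_aleph0)
        · rw [mk_finset_of_infinite]
          exact le_max_right _ _
      have h3 : Cardinal.lift.{u} #(Finset p) ≤ Cardinal.lift.{max u u₂ v₂} κ := by
        refine (Cardinal.lift_le.2 h2).trans ?_
        rw [Cardinal.lift_max, Cardinal.lift_aleph0]
        exact max_le (Cardinal.aleph0_le_lift.2 hκ) hcard
      exact Cardinal.lift_le.1 (h1.trans h3)
    obtain ⟨q₀, hq₀p, hq₀fin, hq₀⟩ := hp.implies_mem k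
    obtain ⟨Q₀, hQ₀⟩ : ∃ Q₀ : Finset p, ∀ φ (hφ : φ ∈ q₀), (⟨φ, hq₀p hφ⟩ : p) ∈ Q₀ := by
      refine ⟨(hq₀fin.preimage Subtype.val_injective.injOn).toFinset, fun φ hφ => ?_⟩
      simpa using hφ
    obtain ⟨x, hx⟩ := s.sInter_nonempty hκ hs (hp.mem_or k) (hp.nontrivial_or_finite k)
      (Set.range D) hsmall (by rintro _ ⟨q, rfl⟩; exact hdef q) (by
        intro 𝓖 h𝓖 hfin
        choose! f hf using h𝓖
        obtain ⟨v, hv, hvw⟩ := hw (hfin.toFinset.biUnion f ∪ Q₀)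
        refine ⟨⟨fun j => v ⟨k, j⟩, hq₀ v fun φ hφ =>
          hv ⟨φ, hq₀p hφ⟩ (Finset.mem_union_right _ (hQ₀ φ hφ))⟩, fun E hE => ?_⟩
        rw [← hf hE]
        refine ⟨v, ⟨fun φ hφ => hv φ (Finset.mem_union_left _ ?_), hvw⟩, fun j => rfl⟩
        exact Finset.mem_biUnion.2 ⟨E, hfin.mem_toFinset.2 hE, hφ⟩)
    refine ⟨fun ij => if h : ij.1 = k then x.1 (h ▸ ij.2) else w ij, fun q => ?_⟩
    obtain ⟨v, ⟨hv1, hv2⟩, hv3⟩ := hx (D q) ⟨q, rfl⟩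
    refine ⟨v, hv1, ?_⟩
    rintro ⟨i, hi⟩ j
    by_cases hik : i = k
    · subst hik
      simpa using hv3 j
    · simpa [hik] using hv2 ⟨i, (Finset.mem_insert.1 hi).resolve_left hik⟩ j

/-- For finite `κ` this is finite satisfiability itself. -/
theorem IsOrType.isRealized {s : CofinalitySpectrumProblem ι N} {κ : Cardinal.{u}}
    (hs : (κ : WithTop Cardinal.{u}) < min s.p s.t) {A : Set N} {n : ℕ}
    {a : Fin n → DefOrder L N} {p : Set (L'[[A]].Formula (Σ i : Fin n, Fin (a i).form.nx))}
    (hp : s.IsOrType A a p) (hcard : Cardinal.lift.{u} #p ≤ Cardinal.lift.{max u u₂ v₂} κ) :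
    IsRealized p := by
  rcases lt_or_ge κ ℵ₀ with hfin | hκ
  · have hpfin : #p < ℵ₀ := by
      rw [← Cardinal.lift_lt_aleph0.{_, u}]
      exact hcard.trans_lt (Cardinal.lift_lt_aleph0.2 hfin)
    exact hp.finitelySatisfiable p subset_rfl (Cardinal.lt_aleph0_iff_set_finite.1 hpfin)
  · obtain ⟨w, hw⟩ := s.exists_assignment hκ hs hp hcard Finset.univ
    refine ⟨w, fun φ hφ => ?_⟩
    obtain ⟨v, hv, hvw⟩ := hw {⟨φ, hφ⟩}
    have heq : v = w := funext fun ij => hvw ⟨ij.1, Finset.mem_univ _⟩ ij.2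
    exact heq ▸ hv ⟨φ, hφ⟩ (Finset.mem_singleton_self _)

end CofinalitySpectrumProblem

theorem mainTheorem7 {L : FirstOrder.Language.{u₁, v₁}} {L' : FirstOrder.Language.{u₂, v₂}} {ι : L →ᴸ L'} {N : Type u}
    [L.Structure N] [L'.Structure N] (s : CofinalitySpectrumProblem ι N)
    (κ : Cardinal.{u}) (hκ : (κ : WithTop Cardinal.{u}) < min s.p s.t) :
    (ℵ₀ ≤ κ → Cardinal.lift.{u} L'.card ≤ Cardinal.lift.{max u₂ v₂} κ →
      ∀ A : Set N, #A ≤ κ →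
        ∀ (n : ℕ) (a : Fin n → DefOrder L N)
          (p : Set (L'[[A]].Formula (Σ i : Fin n, Fin (a i).form.nx))),
          s.IsOrType A a p → CofinalitySpectrumProblem.IsRealized p) ∧
    (∀ (A : Set N) (n : ℕ) (a : Fin n → DefOrder L N)
        (p : Set (L'[[A]].Formula (Σ i : Fin n, Fin (a i).form.nx))),
        s.IsOrType A a p →
        Cardinal.lift.{u} #p ≤ Cardinal.lift.{max u u₂ v₂} κ →
        CofinalitySpectrumProblem.IsRealized p) :=
  ⟨fun hinf hL _ hA _ _ p hp =>
      hp.isRealized hκ (lift_mk_formula_withConstants_le hinf hL hA p),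
    fun _ _ _ _ hp hcard => hp.isRealized hκ hcard⟩
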